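/- Let $d,m,N$ be natural numbers, $1\le t\le N$, and let $\beta_1,\dots,\beta_N\in(0,1)$ be a noise schedule with $\alpha_j=1-\beta_j$ and $\bar\alpha_t=\prod_{j=1}^{t}\alpha_j$. Let $x_0\in\mathbb{R}^d$ be a random vector with an arbitrary law $p_{\mathrm{data}}$, and let $x_1,\dots,x_N$ be the variance-preserving (DDPM) forward diffusion $x_i=\sqrt{1-\beta_i}\,x_{i-1}+\sqrt{\beta_i}\,\varepsilon_i$, where $\varepsilon_1,\dots,\varepsilon_N\sim\mathcal N(0,I)$ are independent of each other and of $x_0$. Let $y=Ax_0+n$ with $A\in\mathbb{R}^{m\times d}$ and $n\sim\mathcal N(0,\Sigma_n)$, where $\Sigma_n$ is positive definite and $n$ is independent of $(x_0,\varepsilon_1,\dots,\varepsilon_N)$. Let $p_t$ be the continuous probability density of $x_t$. For a point $x$ write $$I(x_0;y\mid x_t=x)=D_{\mathrm{KL}}\big(P_{(x_0,y)\mid x_t=x}\,\big\|\,P_{x_0\mid x_t=x}\otimes P_{y\mid x_t=x}\big)$$ for the conditional mutual information (in nats) at $x_t=x$. Then for almost every $x$ (with respect to the law of $x_t$) at which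 the conditional law of $x_0$ given $x_t=x$ is a Gaussian $\mathcal N(\mu_{\mathrm{post}},\Sigma_{\mathrm{post}})$ with positive definite covariance $\Sigma_{\mathrm{post}}$, the following holds. The density $p_t$ is positive at $x$ and twice continuously differentiable near $x$, $$\Sigma_{\mathrm{post}}=\frac{1-\bar\alpha_t}{\bar\alpha_t}\Big(I+(1-\bar\alpha_t)\,\nabla^2\log p_t(x)\Big),$$ and $I(x_0;y\mid x_t=x)$ is finite and equal to $$I(x_0;y\mid x_t=x)=\frac12\log\frac{\det\Sigma_{\mathrm{post}}}{\det\Sigma_{\mathrm{post},y}},\qquad \Sigma_{\mathrm{post},y}=\big(\Sigma_{\mathrm{post}}^{-1}+A^{\mathsf T}\Sigma_n^{-1}A\big)^{-1}.$$ -/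

import Mathlib

open MeasureTheory ProbabilityTheory InformationTheory
open scoped ENNReal

namespace DiffusionCMI

/-- The cumulative noise level `ᾱ_t = ∏_{j=1}^t α_j`, where `α_j = 1 - β_j`. -/
noncomputable def alphaBar (β : ℕ → ℝ) (t : ℕ) : ℝ :=
  ∏ j ∈ Finset.Icc 1 t, (1 - β j)

/-- The Hessian matrix `[∇² f (x)]_{ij} = ∂² f (x) / ∂x_i ∂x_j`. -/
noncomputable def hessian {d : ℕ} (f : EuclideanSpace ℝ (Fin d) → ℝ)
    (x : EuclideanSpace ℝ (Fin d)) : Matrix (Fin d) (Fin d) ℝ :=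
  Matrix.of fun i j =>
    fderiv ℝ (fun z => fderiv ℝ f z (EuclideanSpace.single j 1)) x (EuclideanSpace.single i 1)

/-- `X 0, …, X N` is the variance-preserving (DDPM) forward diffusion with noise schedule
`β 1, …, β N`, started from the data distribution `pdata` and driven by the independent standard
Gaussian vectors `ε 1, …, ε N`, which are independent of `X 0`:
`X i = √(1 - β i) • X (i - 1) + √(β i) • ε i`. -/
structure IsForwardDiffusion {Ω : Type*} [MeasurableSpace Ω] {d : ℕ} (N : ℕ) (β : ℕ → ℝ)
    (pdata : Measure (EuclideanSpace ℝ (Fin d))) (X ε : ℕ → Ω → EuclideanSpace ℝ (Fin d))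
    (P : Measure Ω) : Prop where
  schedule : ∀ i ∈ Finset.Icc 1 N, 0 < β i ∧ β i < 1
  init : HasLaw (X 0) pdata P
  noise_law : ∀ i ∈ Finset.Icc 1 N, HasLaw (ε i) (stdGaussian (EuclideanSpace ℝ (Fin d))) P
  noise_indep : iIndepFun (fun i : Finset.Icc 1 N => ε i) P
  init_indep : IndepFun (X 0) (fun ω (i : Finset.Icc 1 N) => ε i ω) P
  step : ∀ i < N, ∀ᵐ ω ∂P,
    X (i + 1) ω = Real.sqrt (1 - β (i + 1)) • X i ω + Real.sqrt (β (i + 1)) • ε (i + 1) ω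

/-- `Y` is the measurement `A x₀ + n`, where the noise `n` has law `N(0, Σn)` and is independent
of everything that drives the forward diffusion. -/
structure IsMeasurement {Ω : Type*} [MeasurableSpace Ω] {d m : ℕ} (N : ℕ)
    (A : Matrix (Fin m) (Fin d) ℝ) (Sn : Matrix (Fin m) (Fin m) ℝ)
    (X ε : ℕ → Ω → EuclideanSpace ℝ (Fin d)) (n Y : Ω → EuclideanSpace ℝ (Fin m))
    (P : Measure Ω) : Prop where
  noise_law : HasLaw n (multivariateGaussian 0 Sn) P
  noise_indep : IndepFun (fun ω => (X 0 ω, fun i : Finset.Icc 1 N => ε i ω)) n P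
  eq : ∀ᵐ ω ∂P, Y ω = A.toEuclideanLin (X 0 ω) + n ω

/-- The conditional mutual information `I(X; Y | Z = z)`, in nats: the Kullback-Leibler divergence
of the conditional law of `(X, Y)` given `Z = z` from the product of the conditional laws of `X`
and of `Y` given `Z = z`. -/
noncomputable def condMutualInfo {Ω E F G : Type*} [MeasurableSpace Ω]
    [MeasurableSpace E] [StandardBorelSpace E] [Nonempty E]
    [MeasurableSpace F] [StandardBorelSpace F] [Nonempty F] [MeasurableSpace G]
    (X : Ω → E) (Y : Ω → F) (Z : Ω → G) (P : Measure Ω) [IsFiniteMeasure P] (z : G) : ℝ≥0∞ :=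
  klDiv (condDistrib (fun ω => (X ω, Y ω)) Z P z)
    ((condDistrib X Z P z).prod (condDistrib Y Z P z))

end DiffusionCMI

/-!
Write `α = ᾱ_t`, `b = 1 / (2 (1 - α))` and `C` for the normalising constant of the density
`C exp (-b ‖v‖²)` of `N(0, (1 - α) I)`.

Unrolling the recursion gives `X t = √α X 0 + W` with `W` independent of `X 0` and of law
`N(0, (1 - α) I)` (`IsForwardDiffusion.exists_noise`). By Bayes' formula
(`condDistrib_additiveNoise`) the law of `X t` has the density
`q z = ∫ C exp (-b ‖z - √α u‖²) dpdata(u)`, and the posterior at almost every `x` is `pdata`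
reweighted by `C exp (-b ‖x - √α u‖²) / q x`. If the posterior at a single such `x` is `N(μ, S)`,
then `pdata` can be recovered from it, and dividing the two Gaussian factors leaves
`q z = q x · exp (-b (‖z‖² - ‖x‖²)) · 𝔼_{u ∼ N(μ, S)} exp ⟪2 b √α (z - x), u⟫` for *every* `z`
(`marginal_of_gaussian_posterior`). The exponential moments of a Gaussian make `log q` a quadratic
polynomial with Hessian `-2 b I + 4 b² α S` (`hessian_const_add_logProfile`). The formula for `S`
follows by solving for `S`, and the smoothness and positivity of the density come for free. No
differentiation under an integral over a general `pdata` is needed.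

The measurement noise is independent of `(X 0, X t)`, so conditionally on `X t = x` the pair
`(X 0, Y)` is a linear Gaussian channel with input `N(μ, S)` (`condDistrib_measurement`). Its joint
law has an explicit density with respect to the product of the marginals (`map_channel_joint`); the
two quadratic forms in the logarithm of that density are squared norms of standard Gaussian vectors
of the same dimension, so their means cancel, and only
`1/2 log (det (A S Aᵀ + Σn) / det Σn)` remains (`klDiv_channel`). Sylvester's identity
(`det_channelCov_div`) rewrites the ratio as `det S / det (S⁻¹ + Aᵀ Σn⁻¹ A)⁻¹`.
-/

namespace DiffusionCMI

/-! ### Densities of isotropic Gaussian laws -/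

section IsotropicDensity

/-- The constant that turns `exp (-b ‖v‖²)` into a probability density on `E`. -/
noncomputable def gaussConst (E : Type*) [AddCommGroup E] [Module ℝ E] (b : ℝ) : ℝ :=
  (Real.pi / b) ^ (-((Module.finrank ℝ E : ℝ) / 2))

theorem gaussConst_pos {E : Type*} [AddCommGroup E] [Module ℝ E] {b : ℝ} (hb : 0 < b) :
    0 < gaussConst E b :=
  Real.rpow_pos_of_pos (by positivity) _

variable {E : Type*} [NormedAddCommGroup E] [InnerProductSpace ℝ E] [FiniteDimensional ℝ E]
  [MeasurableSpace E] [BorelSpace E]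

theorem integrable_exp_neg_mul_norm_sq {b : ℝ} (hb : 0 < b) :
    Integrable (fun v : E => Real.exp (-b * ‖v‖ ^ 2)) := by
  have h := GaussianFourier.integrable_cexp_neg_mul_sq_norm_add (V := E) (b := (b : ℂ))
    (by simpa using hb) 0 0
  refine (h.re).congr (Filter.Eventually.of_forall fun v => ?_)
  simp only [zero_mul, add_zero]
  rw [show (-(b : ℂ) * (‖v‖ : ℂ) ^ 2) = ((-b * ‖v‖ ^ 2 : ℝ) : ℂ) by push_cast; ring,
    ← Complex.ofReal_exp]
  rfl

/-- The isotropic centred Gaussian law of variance `1 / (2 b)`, given by its characteristic function,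
has a density proportional to `exp (-b ‖v‖²)`. -/
theorem eq_withDensity_of_charFun (μ : Measure E) [IsFiniteMeasure μ] {b : ℝ} (hb : 0 < b)
    (hμ : ∀ w, charFun μ w = Complex.exp (-((‖w‖ ^ 2 / (4 * b) : ℝ) : ℂ))) :
    μ = volume.withDensity fun v => ENNReal.ofReal (gaussConst E b * Real.exp (-b * ‖v‖ ^ 2)) := by
  have hc := gaussConst_pos (E := E) hb
  have hfin : IsFiniteMeasure (volume.withDensity fun v : E =>
      ENNReal.ofReal (gaussConst E b * Real.exp (-b * ‖v‖ ^ 2))) :=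
    isFiniteMeasure_withDensity_ofReal
      ((integrable_exp_neg_mul_norm_sq hb).const_mul _).hasFiniteIntegral
  refine Measure.ext_of_charFun (funext fun w => ?_)
  rw [hμ, charFun_apply, integral_withDensity_eq_integral_toReal_smul (by fun_prop) (by simp)]
  have hF := GaussianFourier.integral_cexp_neg_mul_sq_norm_add (V := E) (b := (b : ℂ))
    (by simpa using hb) Complex.I w
  have : ∀ v : E, (ENNReal.ofReal (gaussConst E b * Real.exp (-b * ‖v‖ ^ 2))).toReal •
      Complex.exp ((inner ℝ v w : ℝ) * Complex.I) = (gaussConst E b : ℂ) *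
        Complex.exp (-(b : ℂ) * (‖v‖ : ℂ) ^ 2 + Complex.I * (inner ℝ w v : ℝ)) := by
    intro v
    rw [ENNReal.toReal_ofReal (by positivity), Complex.real_smul, real_inner_comm, Complex.exp_add]
    push_cast
    ring_nf
  simp_rw [this]
  rw [integral_const_mul, hF]
  have hk : (gaussConst E b : ℂ) * ((Real.pi : ℂ) / b) ^ ((Module.finrank ℝ E : ℂ) / 2) = 1 := by
    have : ((Real.pi : ℂ) / b) ^ ((Module.finrank ℝ E : ℂ) / 2) =
        (((Real.pi / b) ^ ((Module.finrank ℝ E : ℝ) / 2) : ℝ) : ℂ) := by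
      rw [Complex.ofReal_cpow (by positivity)]
      push_cast
      rfl
    rw [this, gaussConst, ← Complex.ofReal_mul, ← Real.rpow_add (by positivity)]
    simp
  rw [← mul_assoc, hk, one_mul]
  congr 1
  push_cast
  rw [Complex.I_sq]
  ring

theorem stdGaussian_eq_withDensity :
    stdGaussian E = volume.withDensity fun v =>
      ENNReal.ofReal (gaussConst E (1 / 2) * Real.exp (-(1 / 2) * ‖v‖ ^ 2)) := by
  refine eq_withDensity_of_charFun _ (by norm_num) fun w => ?_
  rw [charFun_stdGaussian]
  push_cast
  ring_nf

end IsotropicDensity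

/-! ### Density and exponential moments of the multivariate Gaussian -/

section Multivariate

variable {ι : Type*} [Fintype ι] [DecidableEq ι]

open scoped MatrixOrder

theorem sqrt_mul_sqrt_of_posDef {S : Matrix ι ι ℝ} (hS : S.PosDef) :
    CFC.sqrt S * CFC.sqrt S = S :=
  CFC.sqrt_mul_sqrt_self _ hS.posSemidef.nonneg

theorem abs_det_sqrt {S : Matrix ι ι ℝ} (hS : S.PosDef) :
    |(CFC.sqrt S).det| = Real.sqrt S.det := by
  rw [← Real.sqrt_sq_eq_abs, sq, ← Matrix.det_mul, sqrt_mul_sqrt_of_posDef hS]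

theorem det_sqrt_ne_zero {S : Matrix ι ι ℝ} (hS : S.PosDef) : (CFC.sqrt S).det ≠ 0 := by
  rw [← abs_pos, abs_det_sqrt hS]
  exact Real.sqrt_pos.2 hS.det_pos

/-- The whitening map `S ^ (-1/2)`, for positive definite `S`. -/
noncomputable def whiten (S : Matrix ι ι ℝ) : EuclideanSpace ℝ ι →L[ℝ] EuclideanSpace ℝ ι :=
  Matrix.toEuclideanCLM (𝕜 := ℝ) (CFC.sqrt S)⁻¹

theorem whiten_sqrt {S : Matrix ι ι ℝ} (hS : S.PosDef) (z : EuclideanSpace ℝ ι) :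
    whiten S (Matrix.toEuclideanCLM (𝕜 := ℝ) (CFC.sqrt S) z) = z := by
  rw [whiten, ← mul_apply_eq_comp, ← map_mul,
    Matrix.nonsing_inv_mul _ (det_sqrt_ne_zero hS).isUnit]
  simp

/-- The density of `N(μ, S)`, with the quadratic form `(x - μ)ᵀ S⁻¹ (x - μ)` written as the squared
norm of the whitened vector. -/
noncomputable def gaussDensity (μ : EuclideanSpace ℝ ι) (S : Matrix ι ι ℝ)
    (x : EuclideanSpace ℝ ι) : ℝ :=
  gaussConst (EuclideanSpace ℝ ι) (1 / 2) * (Real.sqrt S.det)⁻¹ *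
    Real.exp (-(1 / 2) * ‖whiten S (x - μ)‖ ^ 2)

theorem gaussDensity_pos {S : Matrix ι ι ℝ} (hS : S.PosDef) (μ x : EuclideanSpace ℝ ι) :
    0 < gaussDensity μ S x := by
  have := gaussConst_pos (E := EuclideanSpace ℝ ι) (b := 1 / 2) (by norm_num)
  have := Real.sqrt_pos.2 hS.det_pos
  unfold gaussDensity
  positivity

theorem continuous_gaussDensity (S : Matrix ι ι ℝ) :
    Continuous fun p : EuclideanSpace ℝ ι × EuclideanSpace ℝ ι => gaussDensity p.1 S p.2 := by
  unfold gaussDensity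
  fun_prop

theorem measurable_gaussDensity (μ : EuclideanSpace ℝ ι) (S : Matrix ι ι ℝ) :
    Measurable (gaussDensity μ S) :=
  ((continuous_gaussDensity S).comp (by fun_prop : Continuous fun x => (μ, x))).measurable

theorem multivariateGaussian_eq_withDensity {S : Matrix ι ι ℝ} (hS : S.PosDef)
    (μ : EuclideanSpace ℝ ι) :
    multivariateGaussian μ S = volume.withDensity fun x => ENNReal.ofReal (gaussDensity μ S x) := by
  set R := Matrix.toEuclideanCLM (𝕜 := ℝ) (CFC.sqrt S) with hR
  have hdet : LinearMap.det (R : EuclideanSpace ℝ ι →ₗ[ℝ] EuclideanSpace ℝ ι)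
      = (CFC.sqrt S).det := by
    rw [← LinearMap.det_toLin (PiLp.basisFun 2 ℝ ι)]
    rfl
  have hdet0 : LinearMap.det (R : EuclideanSpace ℝ ι →ₗ[ℝ] EuclideanSpace ℝ ι) ≠ 0 := by
    rw [hdet]; exact det_sqrt_ne_zero hS
  -- change of variables for Lebesgue measure under `z ↦ μ + R z`
  have hvol : (volume : Measure (EuclideanSpace ℝ ι)).map (fun z => μ + R z) =
      ENNReal.ofReal (Real.sqrt S.det)⁻¹ • volume := by
    have h1 := Measure.map_linearMap_addHaar_eq_smul_addHaar
      (volume : Measure (EuclideanSpace ℝ ι)) hdet0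
    rw [hdet, abs_inv, abs_det_sqrt hS] at h1
    change Measure.map ((fun z => μ + z) ∘ (R : EuclideanSpace ℝ ι →ₗ[ℝ] EuclideanSpace ℝ ι)) _ = _
    rw [← Measure.map_map (measurable_const_add μ)
      (show Measurable (R : EuclideanSpace ℝ ι →ₗ[ℝ] EuclideanSpace ℝ ι) from
        R.continuous.measurable), h1, Measure.map_smul,
      map_add_left_eq_self]
  refine Measure.ext_of_lintegral _ fun f hf => ?_
  have hmd : Measurable fun x => ENNReal.ofReal (gaussDensity μ S x) :=
    (measurable_gaussDensity μ S).ennreal_ofReal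
  have hmf : Measurable fun x => ENNReal.ofReal
      (gaussConst (EuclideanSpace ℝ ι) (1 / 2) * Real.exp (-(1 / 2) * ‖whiten S (x - μ)‖ ^ 2)) := by
    fun_prop
  have hmR : Measurable fun z => μ + R z := by fun_prop
  rw [multivariateGaussian, lintegral_map hf hmR, stdGaussian_eq_withDensity,
    lintegral_withDensity_eq_lintegral_mul _ (by fun_prop)
      (show Measurable fun z => f (μ + R z) from hf.comp hmR),
    lintegral_withDensity_eq_lintegral_mul _ hmd hf]
  have h2 := lintegral_map (μ := volume) (hmf.mul hf) hmR
  rw [hvol, lintegral_smul_measure] at h2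
  simp only [Pi.mul_apply, add_sub_cancel_left, hR, whiten_sqrt hS] at h2 ⊢
  rw [← h2, smul_eq_mul, ← lintegral_const_mul' _ _ ENNReal.ofReal_ne_top]
  refine lintegral_congr fun x => ?_
  rw [← mul_assoc, ← ENNReal.ofReal_mul (by positivity), gaussDensity]
  congr 2
  ring

/-- The exponential moments of a multivariate Gaussian. -/
theorem lintegral_exp_inner_multivariateGaussian {S : Matrix ι ι ℝ} (hS : S.PosSemidef)
    (μ v : EuclideanSpace ℝ ι) :
    ∫⁻ x, ENNReal.ofReal (Real.exp (inner ℝ v x)) ∂(multivariateGaussian μ S) =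
      ENNReal.ofReal (Real.exp (inner ℝ v μ +
        inner ℝ v (Matrix.toEuclideanCLM (𝕜 := ℝ) S v) / 2)) := by
  set L : StrongDual ℝ (EuclideanSpace ℝ ι) := innerSL ℝ v with hL
  have hLx : ∀ x, L x = inner ℝ v x := fun x => rfl
  have h := IsGaussian.map_eq_gaussianReal (μ := multivariateGaussian μ S) L
  have hmean : ∫ x, L x ∂(multivariateGaussian μ S) = inner ℝ v μ := by
    rw [L.integral_comp_comm IsGaussian.integrable_fun_id, integral_id_multivariateGaussian, hLx]
  have hvar : Var[L; multivariateGaussian μ S] =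
      inner ℝ v (Matrix.toEuclideanCLM (𝕜 := ℝ) S v) := by
    rw [← covariance_self L.continuous.aemeasurable]
    have := covarianceBilin_apply_eq_cov (μ := multivariateGaussian μ S)
      IsGaussian.memLp_two_id v v
    rw [covarianceBilin_multivariateGaussian hS] at this
    rw [show (⇑L) = fun x => inner ℝ v x from rfl, ← this, Matrix.inner_toEuclideanCLM]
  have hint : Integrable (fun x => Real.exp (L x)) (multivariateGaussian μ S) := by
    have h3 : Integrable (fun y : ℝ => Real.exp (1 * y))
        ((multivariateGaussian μ S).map L) := by
      rw [h]; exact integrable_exp_mul_gaussianReal 1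
    simpa [Function.comp_def] using h3.comp_measurable L.continuous.measurable
  have hmgf := mgf_gaussianReal h 1
  simp only [mgf, one_mul, mul_one, one_pow] at hmgf
  rw [← ofReal_integral_eq_lintegral_ofReal (by simpa [hLx] using hint)
    (Filter.Eventually.of_forall fun _ => (Real.exp_pos _).le)]
  change ENNReal.ofReal (∫ x, Real.exp (L x) ∂(multivariateGaussian μ S)) = _
  rw [hmgf, hmean, Real.coe_toNNReal _ (variance_nonneg _ _), hvar]

end Multivariate

/-! ### Linear Gaussian channels and their mutual information -/

section Channel

variable {ι κ : Type*} [Fintype ι] [DecidableEq ι] [Fintype κ] [DecidableEq κ]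

theorem integrable_norm_sq_stdGaussian {ι : Type*} [Fintype ι] :
    Integrable (fun z : EuclideanSpace ℝ ι => ‖z‖ ^ 2) (stdGaussian (EuclideanSpace ℝ ι)) := by
  have h := (IsGaussian.memLp_two_id (μ := stdGaussian (EuclideanSpace ℝ ι)))
  exact (memLp_two_iff_integrable_sq_norm h.1).1 h

theorem integrable_norm_whiten_sq {S : Matrix ι ι ℝ} (hS : S.PosDef) (μ : EuclideanSpace ℝ ι) :
    Integrable (fun x => ‖whiten S (x - μ)‖ ^ 2) (multivariateGaussian μ S) := by
  rw [multivariateGaussian, integrable_map_measure (by fun_prop) (by fun_prop)]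
  simpa [Function.comp_def, whiten_sqrt hS] using integrable_norm_sq_stdGaussian

/-- Whitening turns any nondegenerate Gaussian into the standard one, so the mean of the quadratic
form in the exponent of the density depends on the dimension only. -/
theorem integral_norm_whiten_sq {S : Matrix ι ι ℝ} (hS : S.PosDef) (μ : EuclideanSpace ℝ ι) :
    ∫ x, ‖whiten S (x - μ)‖ ^ 2 ∂(multivariateGaussian μ S) =
      ∫ z, ‖z‖ ^ 2 ∂(stdGaussian (EuclideanSpace ℝ ι)) := by
  rw [multivariateGaussian, integral_map (by fun_prop) (by fun_prop)]
  simp [whiten_sqrt hS]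

theorem map_const_add_multivariateGaussian (S : Matrix ι ι ℝ) (μ : EuclideanSpace ℝ ι) :
    (multivariateGaussian 0 S).map (fun n => μ + n) = multivariateGaussian μ S := by
  rw [multivariateGaussian, multivariateGaussian, Measure.map_map (by fun_prop) (by fun_prop)]
  simp [Function.comp_def]

theorem posDef_channelCov {ι κ : Type*} [Fintype ι] [Fintype κ]
    {Sx : Matrix ι ι ℝ} (hSx : Sx.PosDef) {Sn : Matrix κ κ ℝ}
    (hSn : Sn.PosDef) (A : Matrix κ ι ℝ) : (A * Sx * A.transpose + Sn).PosDef := by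
  have h : (A * Sx * A.conjTranspose).PosSemidef := hSx.posSemidef.mul_mul_conjTranspose_same A
  simp only [Matrix.conjTranspose_eq_transpose_of_trivial] at h
  exact Matrix.PosDef.posSemidef_add h hSn

/-- The output of the linear Gaussian channel `x ↦ A x + n` with Gaussian input is Gaussian. -/
theorem map_channel_output {Sx : Matrix ι ι ℝ} (hSx : Sx.PosDef) {Sn : Matrix κ κ ℝ}
    (hSn : Sn.PosDef) (A : Matrix κ ι ℝ) (μ : EuclideanSpace ℝ ι) :
    ((multivariateGaussian μ Sx).prod (multivariateGaussian 0 Sn)).map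
        (fun p => A.toEuclideanLin p.1 + p.2) =
      multivariateGaussian (A.toEuclideanLin μ) (A * Sx * A.transpose + Sn) := by
  have hA : Measurable A.toEuclideanLin :=
    (LinearMap.continuous_of_finiteDimensional _).measurable
  have h1 : ((multivariateGaussian μ Sx).prod (multivariateGaussian 0 Sn)).map
        (fun p => A.toEuclideanLin p.1 + p.2) =
      (((multivariateGaussian μ Sx).map A.toEuclideanLin).prod
        (multivariateGaussian 0 Sn)).map (fun p => p.1 + p.2) := by
    conv_rhs => rw [← Measure.map_id (μ := multivariateGaussian 0 Sn)]
    rw [Measure.map_prod_map _ _ hA measurable_id, Measure.map_map (by fun_prop) (by fun_prop)]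
    rfl
  have : IsProbabilityMeasure ((multivariateGaussian μ Sx).map A.toEuclideanLin) :=
    Measure.isProbabilityMeasure_map hA.aemeasurable
  have hadj : ∀ x t, inner ℝ (A.toEuclideanLin x) t =
      inner ℝ x (A.transpose.toEuclideanLin t) := by
    intro x t
    simp [EuclideanSpace.inner_eq_star_dotProduct, Matrix.toLpLin_apply, Matrix.dotProduct_mulVec,
      Matrix.vecMul_transpose, dotProduct_comm]
  rw [h1]
  refine Measure.ext_of_charFun ?_
  rw [charFun_map_add_prod_eq_mul]
  ext t
  have h2 : charFun ((multivariateGaussian μ Sx).map A.toEuclideanLin) t =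
      charFun (multivariateGaussian μ Sx) (A.transpose.toEuclideanLin t) := by
    rw [charFun_apply, charFun_apply, integral_map hA.aemeasurable (by fun_prop)]
    simp_rw [hadj]
  rw [Pi.mul_apply, h2, charFun_multivariateGaussian hSx.posSemidef,
    charFun_multivariateGaussian hSn.posSemidef,
    charFun_multivariateGaussian (posDef_channelCov hSx hSn A).posSemidef, ← Complex.exp_add]
  congr 1
  rw [real_inner_comm, ← hadj, real_inner_comm]
  have h3 : (A.transpose.toEuclideanLin t).ofLp ⬝ᵥ Sx.mulVec (A.transpose.toEuclideanLin t).ofLp =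
      t.ofLp ⬝ᵥ (A * Sx * A.transpose).mulVec t.ofLp := by
    simp only [Matrix.toLpLin_apply]
    rw [← Matrix.mulVec_mulVec, ← Matrix.mulVec_mulVec, Matrix.dotProduct_mulVec t.ofLp A,
      Matrix.mulVec_transpose]
  rw [h3, Matrix.add_mulVec, dotProduct_add]
  simp
  ring

/-- The joint law of input and output of a linear Gaussian channel, as a density with respect to
the product of its marginals: the ratio of the conditional to the marginal output density. -/
theorem map_channel_joint {Sx : Matrix ι ι ℝ} (hSx : Sx.PosDef) {Sn : Matrix κ κ ℝ}
    (hSn : Sn.PosDef) (A : Matrix κ ι ℝ) (μ : EuclideanSpace ℝ ι) :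
    ((multivariateGaussian μ Sx).prod (multivariateGaussian 0 Sn)).map
        (fun p => (p.1, A.toEuclideanLin p.1 + p.2)) =
      ((multivariateGaussian μ Sx).prod
        (multivariateGaussian (A.toEuclideanLin μ) (A * Sx * A.transpose + Sn))).withDensity
        (fun p => ENNReal.ofReal (gaussDensity (A.toEuclideanLin p.1) Sn p.2 /
          gaussDensity (A.toEuclideanLin μ) (A * Sx * A.transpose + Sn) p.2)) := by
  set S := A * Sx * A.transpose + Sn
  have hS : S.PosDef := posDef_channelCov hSx hSn A
  have hAc : Continuous A.toEuclideanLin := LinearMap.continuous_of_finiteDimensional _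
  have hA := hAc.measurable
  have hg : Measurable fun p : EuclideanSpace ℝ ι × EuclideanSpace ℝ κ =>
      gaussDensity (A.toEuclideanLin p.1) Sn p.2 :=
    ((continuous_gaussDensity Sn).comp (by fun_prop :
      Continuous fun p : EuclideanSpace ℝ ι × EuclideanSpace ℝ κ =>
        (A.toEuclideanLin p.1, p.2))).measurable
  have hgS := measurable_gaussDensity (A.toEuclideanLin μ) S
  have hr : Measurable fun p : EuclideanSpace ℝ ι × EuclideanSpace ℝ κ =>
      ENNReal.ofReal (gaussDensity (A.toEuclideanLin p.1) Sn p.2 /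
          gaussDensity (A.toEuclideanLin μ) S p.2) :=
    (hg.div (hgS.comp measurable_snd)).ennreal_ofReal
  refine Measure.ext_of_lintegral _ fun f hf => ?_
  rw [lintegral_map hf (by fun_prop), lintegral_withDensity_eq_lintegral_mul _ hr hf,
    lintegral_prod _ (by fun_prop), lintegral_prod _ (hr.mul hf).aemeasurable]
  refine lintegral_congr fun x => ?_
  have hfx : Measurable fun y => f (x, y) := by fun_prop
  have h1 := lintegral_map (μ := multivariateGaussian 0 Sn) hfx
    (measurable_const_add (A.toEuclideanLin x))
  rw [map_const_add_multivariateGaussian, multivariateGaussian_eq_withDensity hSn,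
    lintegral_withDensity_eq_lintegral_mul _ (measurable_gaussDensity _ _).ennreal_ofReal hfx] at h1
  have hrf : Measurable fun y => ((fun p : EuclideanSpace ℝ ι × EuclideanSpace ℝ κ =>
      ENNReal.ofReal (gaussDensity (A.toEuclideanLin p.1) Sn p.2 /
          gaussDensity (A.toEuclideanLin μ) S p.2)) * f) (x, y) :=
    (hr.mul hf).comp (by fun_prop)
  rw [← h1, multivariateGaussian_eq_withDensity hS,
    lintegral_withDensity_eq_lintegral_mul _ hgS.ennreal_ofReal hrf]
  refine lintegral_congr fun y => ?_
  have hpos := gaussDensity_pos hS (A.toEuclideanLin μ) y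
  simp only [Pi.mul_apply]
  rw [← mul_assoc, ← ENNReal.ofReal_mul hpos.le, mul_div_cancel₀ _ hpos.ne']

theorem log_gaussDensity {S : Matrix ι ι ℝ} (hS : S.PosDef) (μ x : EuclideanSpace ℝ ι) :
    Real.log (gaussDensity μ S x) = Real.log (gaussConst (EuclideanSpace ℝ ι) (1 / 2)) -
      1 / 2 * Real.log S.det - 1 / 2 * ‖whiten S (x - μ)‖ ^ 2 := by
  have h1 := gaussConst_pos (E := EuclideanSpace ℝ ι) (b := 1 / 2) (by norm_num)
  have h2 := Real.sqrt_pos.2 hS.det_pos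
  rw [gaussDensity, Real.log_mul (by positivity) (Real.exp_pos _).ne',
    Real.log_mul h1.ne' (by positivity), Real.log_inv, Real.log_sqrt hS.det_pos.le, Real.log_exp]
  ring

/-- The mutual information of a linear Gaussian channel with Gaussian input is finite and equal to
`1/2 log (det (A Sx Aᵀ + Sn) / det Sn)`. -/
theorem klDiv_channel {Sx : Matrix ι ι ℝ} (hSx : Sx.PosDef) {Sn : Matrix κ κ ℝ}
    (hSn : Sn.PosDef) (A : Matrix κ ι ℝ) (μ : EuclideanSpace ℝ ι) :
    klDiv (((multivariateGaussian μ Sx).prod (multivariateGaussian 0 Sn)).map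
        (fun p => (p.1, A.toEuclideanLin p.1 + p.2)))
      ((multivariateGaussian μ Sx).prod
        (multivariateGaussian (A.toEuclideanLin μ) (A * Sx * A.transpose + Sn))) ≠ ⊤ ∧
    (klDiv (((multivariateGaussian μ Sx).prod (multivariateGaussian 0 Sn)).map
        (fun p => (p.1, A.toEuclideanLin p.1 + p.2)))
      ((multivariateGaussian μ Sx).prod
        (multivariateGaussian (A.toEuclideanLin μ) (A * Sx * A.transpose + Sn)))).toReal =
      1 / 2 * Real.log ((A * Sx * A.transpose + Sn).det / Sn.det) := by
  have hjoint := map_channel_joint hSx hSn A μ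
  have hout := map_channel_output hSx hSn A μ
  have hS : (A * Sx * A.transpose + Sn).PosDef := posDef_channelCov hSx hSn A
  set S := A * Sx * A.transpose + Sn
  set G := (multivariateGaussian μ Sx).prod (multivariateGaussian 0 Sn)
  set J := G.map (fun p => (p.1, A.toEuclideanLin p.1 + p.2)) with hJ
  set Q := (multivariateGaussian μ Sx).prod (multivariateGaussian (A.toEuclideanLin μ) S)
  have hAc : Continuous A.toEuclideanLin := LinearMap.continuous_of_finiteDimensional _
  have hA := hAc.measurable
  have hT : Measurable fun p : EuclideanSpace ℝ ι × EuclideanSpace ℝ κ =>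
      (p.1, A.toEuclideanLin p.1 + p.2) := by fun_prop
  have hg : Measurable fun p : EuclideanSpace ℝ ι × EuclideanSpace ℝ κ =>
      gaussDensity (A.toEuclideanLin p.1) Sn p.2 :=
    ((continuous_gaussDensity Sn).comp (by fun_prop :
      Continuous fun p : EuclideanSpace ℝ ι × EuclideanSpace ℝ κ =>
        (A.toEuclideanLin p.1, p.2))).measurable
  have hr := (hg.div ((measurable_gaussDensity (A.toEuclideanLin μ) S).comp
    measurable_snd)).ennreal_ofReal
  have : IsProbabilityMeasure J := Measure.isProbabilityMeasure_map hT.aemeasurable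
  have hac : J ≪ Q := by rw [hjoint]; exact withDensity_absolutelyContinuous _ _
  let ℓ : EuclideanSpace ℝ ι × EuclideanSpace ℝ κ → ℝ := fun p =>
    (1 / 2 * Real.log (S.det / Sn.det) - 1 / 2 * ‖whiten Sn (p.2 - A.toEuclideanLin p.1)‖ ^ 2)
      + 1 / 2 * ‖whiten S (p.2 - A.toEuclideanLin μ)‖ ^ 2
  have hllr : llr J Q =ᵐ[J] ℓ := by
    have h1 := Measure.rnDeriv_withDensity Q hr
    filter_upwards [hac.ae_le (hjoint ▸ h1)] with p hp
    rw [llr, hp]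
    simp only [Pi.div_apply, Function.comp_apply]
    have h1 := gaussDensity_pos hSn (A.toEuclideanLin p.1) p.2
    have h2 := gaussDensity_pos hS (A.toEuclideanLin μ) p.2
    rw [ENNReal.toReal_ofReal (by positivity), Real.log_div h1.ne' h2.ne',
      log_gaussDensity hSn, log_gaussDensity hS]
    simp only [ℓ]
    rw [Real.log_div hS.det_pos.ne' hSn.det_pos.ne']
    ring
  have hℓm : Measurable ℓ := by fun_prop
  -- under the joint law `J`, `p.2 - A p.1` is the noise and `p.2 - A μ` is the centred output;
  -- both are pulled back to the input-noise law `G`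
  have hnoise : G.map (fun p => p.2) = multivariateGaussian 0 Sn :=
    measurePreserving_snd.map_eq
  have hi1 : Integrable (fun p => ‖whiten Sn p.2‖ ^ 2) G := by
    have := integrable_norm_whiten_sq hSn 0
    rw [← hnoise] at this
    simpa [Function.comp_def] using this.comp_measurable (by fun_prop)
  have hi2 : Integrable
      (fun p => ‖whiten S (A.toEuclideanLin p.1 + p.2 - A.toEuclideanLin μ)‖ ^ 2) G := by
    have := integrable_norm_whiten_sq hS (A.toEuclideanLin μ)
    rw [← hout] at this
    exact this.comp_measurable (by fun_prop)
  have he1 : ∫ p, ‖whiten Sn p.2‖ ^ 2 ∂G =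
      ∫ z, ‖z‖ ^ 2 ∂(stdGaussian (EuclideanSpace ℝ κ)) := by
    rw [← integral_norm_whiten_sq hSn 0, ← hnoise, integral_map (by fun_prop) (by fun_prop)]
    simp
  have he2 : ∫ p, ‖whiten S (A.toEuclideanLin p.1 + p.2 - A.toEuclideanLin μ)‖ ^ 2 ∂G =
      ∫ z, ‖z‖ ^ 2 ∂(stdGaussian (EuclideanSpace ℝ κ)) := by
    rw [← integral_norm_whiten_sq hS (A.toEuclideanLin μ), ← hout,
      integral_map (by fun_prop) (by fun_prop)]
  have hℓT : ∀ p : EuclideanSpace ℝ ι × EuclideanSpace ℝ κ,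
      ℓ (p.1, A.toEuclideanLin p.1 + p.2) =
        (1 / 2 * Real.log (S.det / Sn.det) - 1 / 2 * ‖whiten Sn p.2‖ ^ 2) +
          1 / 2 * ‖whiten S (A.toEuclideanLin p.1 + p.2 - A.toEuclideanLin μ)‖ ^ 2 := by
    intro p
    simp [ℓ]
  have hi12 : Integrable (fun p => 1 / 2 * Real.log (S.det / Sn.det) -
      1 / 2 * ‖whiten Sn p.2‖ ^ 2) G := (integrable_const _).sub (hi1.const_mul (1 / 2))
  have hℓint : Integrable ℓ J := by
    rw [hJ, integrable_map_measure hℓm.aestronglyMeasurable hT.aemeasurable]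
    refine (hi12.add (hi2.const_mul (1 / 2))).congr (Filter.Eventually.of_forall fun p => ?_)
    exact (hℓT p).symm
  refine ⟨klDiv_ne_top hac (hℓint.congr hllr.symm), ?_⟩
  rw [toReal_klDiv_of_measure_eq hac (by simp), integral_congr_ae hllr, hJ,
    integral_map hT.aemeasurable hℓm.aestronglyMeasurable]
  simp_rw [hℓT]
  rw [integral_add hi12 (hi2.const_mul (1 / 2)),
    integral_sub (integrable_const _) (hi1.const_mul (1 / 2))]
  simp only [integral_const_mul, he1, he2]
  simp

/-- Sylvester's determinant identity turns the output form of the determinant ratio into the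
posterior-covariance form. -/
theorem det_channelCov_div {Sx : Matrix ι ι ℝ} (hSx : Sx.PosDef) {Sn : Matrix κ κ ℝ}
    (hSn : Sn.PosDef) (A : Matrix κ ι ℝ) :
    (A * Sx * A.transpose + Sn).det / Sn.det =
      Sx.det / ((Sx⁻¹ + A.transpose * Sn⁻¹ * A)⁻¹).det := by
  have hx := hSx.det_pos.ne'
  have hn := hSn.det_pos.ne'
  rw [Matrix.det_nonsing_inv, Ring.inverse_eq_inv', div_inv_eq_mul, ← Matrix.det_mul,
    Matrix.mul_add, Matrix.mul_nonsing_inv _ hx.isUnit, ← Matrix.mul_assoc,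
    Matrix.det_one_add_mul_comm, div_eq_iff hn, ← Matrix.det_mul, Matrix.add_mul, Matrix.one_mul]
  congr 1
  simp only [Matrix.mul_assoc]
  rw [Matrix.nonsing_inv_mul _ hn.isUnit, Matrix.mul_one, add_comm]

end Channel

/-! ### Conditional laws in additive noise -/

section Conditioning

/-- Bayes' formula for a signal observed in additive noise with a density. -/
theorem condDistrib_additiveNoise {Ω E : Type*} [MeasurableSpace Ω] {P : Measure Ω}
    [IsProbabilityMeasure P] [NormedAddCommGroup E] [InnerProductSpace ℝ E]
    [FiniteDimensional ℝ E] [MeasurableSpace E] [BorelSpace E] {X₀ W X : Ω → E} {a : ℝ}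
    (hX₀ : AEMeasurable X₀ P) (hW : AEMeasurable W P) (hind : IndepFun X₀ W P)
    {g : E → ℝ≥0∞} (hg : Measurable g) (hWg : P.map W = volume.withDensity g)
    (hX : ∀ᵐ ω ∂P, X ω = a • X₀ ω + W ω)
    (h0 : ∀ x, ∫⁻ u, g (x - a • u) ∂(P.map X₀) ≠ 0)
    (h1 : ∀ x, ∫⁻ u, g (x - a • u) ∂(P.map X₀) ≠ ⊤) :
    P.map X = volume.withDensity (fun x => ∫⁻ u, g (x - a • u) ∂(P.map X₀)) ∧
    ∀ᵐ x ∂(P.map X), condDistrib X₀ X P x = (P.map X₀).withDensity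
      (fun u => g (x - a • u) / ∫⁻ u, g (x - a • u) ∂(P.map X₀)) := by
  have hXm : AEMeasurable X P :=
    ((hX₀.const_smul a).add hW).congr (by filter_upwards [hX] with ω h using h.symm)
  have : IsProbabilityMeasure (P.map X₀) := Measure.isProbabilityMeasure_map hX₀
  have : IsProbabilityMeasure (P.map X) := Measure.isProbabilityMeasure_map hXm
  set π := P.map X₀ with hπ
  have hG : Measurable fun p : E × E => g (p.1 - a • p.2) := by fun_prop
  set q : E → ℝ≥0∞ := fun x => ∫⁻ u, g (x - a • u) ∂π with hq
  have hqm : Measurable q := hG.lintegral_prod_right'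
  -- the joint law of `X` and `X₀`, tested against nonnegative functions
  have hjoint : ∀ f : E × E → ℝ≥0∞, Measurable f →
      ∫⁻ p, f p ∂(P.map fun ω => (X ω, X₀ ω)) =
        ∫⁻ x, ∫⁻ u, g (x - a • u) * f (x, u) ∂π := by
    intro f hf
    have h2 : P.map (fun ω => (X ω, X₀ ω)) =
        (P.map fun ω => (X₀ ω, W ω)).map fun p => (a • p.1 + p.2, p.1) := by
      rw [AEMeasurable.map_map_of_aemeasurable (by fun_prop) (by fun_prop)]
      refine Measure.map_congr ?_
      filter_upwards [hX] with ω h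
      simp [h]
    rw [h2, (indepFun_iff_map_prod_eq_prod_map_map hX₀ hW).1 hind, hWg,
      lintegral_map hf (by fun_prop)]
    have : SFinite (volume.withDensity g : Measure E) := by rw [← hWg]; infer_instance
    rw [lintegral_prod _ (by fun_prop)]
    have hm : Measurable fun p : E × E => g (p.1 - a • p.2) * f p := hG.mul hf
    rw [lintegral_lintegral_swap (f := fun x u => g (x - a • u) * f (x, u)) hm.aemeasurable]
    refine lintegral_congr fun u => ?_
    rw [lintegral_withDensity_eq_lintegral_mul _ hg (by fun_prop),
      ← lintegral_sub_right_eq_self _ (a • u)]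
    simp
  have hmarg : P.map X = volume.withDensity q := by
    refine Measure.ext_of_lintegral _ fun f hf => ?_
    have h2 := hjoint (fun p => f p.1) (by fun_prop)
    rw [lintegral_map' (by fun_prop) (by fun_prop)] at h2
    rw [lintegral_map' hf.aemeasurable hXm, h2, lintegral_withDensity_eq_lintegral_mul _ hqm hf]
    refine lintegral_congr fun x => ?_
    change ∫⁻ u, g (x - a • u) * f x ∂π = q x * f x
    rw [lintegral_mul_const _ (by fun_prop)]
  refine ⟨hmarg, ?_⟩
  have hD : Measurable (Function.uncurry fun x u : E => g (x - a • u) / q x) := by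
    simp only [Function.uncurry_def]
    exact hG.div (hqm.comp measurable_fst)
  let κ : Kernel E E := Kernel.withDensity (Kernel.const E π) fun x u => g (x - a • u) / q x
  have hκ : ∀ x, κ x = π.withDensity fun u => g (x - a • u) / q x := fun x => by
    rw [Kernel.withDensity_apply _ hD]; rfl
  have hκp : IsMarkovKernel κ := ⟨fun x => ⟨by
    rw [hκ, withDensity_apply _ MeasurableSet.univ, Measure.restrict_univ]
    simp_rw [div_eq_mul_inv]
    rw [lintegral_mul_const _ (by fun_prop)]
    exact ENNReal.mul_inv_cancel (h0 x) (h1 x)⟩⟩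
  have hbayes : P.map (fun ω => (X ω, X₀ ω)) = P.map X ⊗ₘ κ := by
    refine Measure.ext_of_lintegral _ fun f hf => ?_
    have hin : Measurable fun x => ∫⁻ u, f (x, u) ∂(κ x) := hf.lintegral_kernel_prod_right'
    rw [hjoint f hf, Measure.lintegral_compProd hf, hmarg,
      lintegral_withDensity_eq_lintegral_mul _ hqm hin]
    refine lintegral_congr fun x => ?_
    have hDx : Measurable fun u => g (x - a • u) / q x := hD.comp (by fun_prop : Measurable
      fun u => (x, u))
    have hfx : Measurable fun u => f (x, u) := by fun_prop
    rw [Pi.mul_apply, hκ, lintegral_withDensity_eq_lintegral_mul _ hDx hfx,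
      ← lintegral_const_mul _ (hDx.mul hfx)]
    refine lintegral_congr fun u => ?_
    rw [Pi.mul_apply, ← mul_assoc, ENNReal.mul_div_cancel (h0 x) (h1 x)]
  filter_upwards [condDistrib_ae_eq_of_measure_eq_compProd X hX₀ hbayes] with x hx
  rw [hx, hκ]

/-- Conditioning on `X` leaves noise that is independent of `(U, X)` independent of `U`. -/
theorem condDistrib_prodMk_of_indep {Ω E F G : Type*} [MeasurableSpace Ω] {P : Measure Ω}
    [IsProbabilityMeasure P] [MeasurableSpace E] [StandardBorelSpace E] [Nonempty E]
    [MeasurableSpace F] [StandardBorelSpace F] [Nonempty F] [MeasurableSpace G]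
    {U : Ω → E} {n : Ω → F} {X : Ω → G} (hU : AEMeasurable U P) (hn : AEMeasurable n P)
    (hX : AEMeasurable X P) (hind : IndepFun (fun ω => (X ω, U ω)) n P) :
    ∀ᵐ x ∂(P.map X), condDistrib (fun ω => (U ω, n ω)) X P x =
      (condDistrib U X P x).prod (P.map n) := by
  have : IsProbabilityMeasure (P.map n) := Measure.isProbabilityMeasure_map hn
  have : IsProbabilityMeasure (P.map X) := Measure.isProbabilityMeasure_map hX
  have key : P.map (fun ω => (X ω, (U ω, n ω))) =
      P.map X ⊗ₘ (condDistrib U X P ×ₖ Kernel.const G (P.map n)) := by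
    refine Measure.ext_of_lintegral _ fun f hf => ?_
    have h2 : P.map (fun ω => (X ω, (U ω, n ω))) =
        (P.map fun ω => ((X ω, U ω), n ω)).map fun p => (p.1.1, (p.1.2, p.2)) := by
      rw [AEMeasurable.map_map_of_aemeasurable (by fun_prop) (by fun_prop)]
      rfl
    rw [h2, (indepFun_iff_map_prod_eq_prod_map_map (by fun_prop) hn).1 hind,
      ← compProd_map_condDistrib hU, lintegral_map hf (by fun_prop),
      lintegral_prod _ (by fun_prop), Measure.lintegral_compProd hf]
    dsimp only
    rw [Measure.lintegral_compProd (f := fun p : G × E => ∫⁻ y, f (p.1, (p.2, y)) ∂(P.map n))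
      (Measurable.lintegral_prod_right' (f := fun z : (G × E) × F => f (z.1.1, (z.1.2, z.2)))
        (by fun_prop))]
    refine lintegral_congr fun x => ?_
    rw [Kernel.prod_apply, Kernel.const_apply, lintegral_prod _ (by fun_prop)]
  filter_upwards [condDistrib_ae_eq_of_measure_eq_compProd X (hU.prodMk hn) key] with x hx
  rw [hx, Kernel.prod_apply, Kernel.const_apply]

/-- A noisy observation `Y = A U + n` turns the conditional law of `U` given `X` into those of
`(U, Y)` and `Y`. -/
theorem condDistrib_measurement {Ω E F G : Type*} [MeasurableSpace Ω] {P : Measure Ω}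
    [IsProbabilityMeasure P] [MeasurableSpace E] [StandardBorelSpace E] [Nonempty E]
    [MeasurableSpace F] [StandardBorelSpace F] [Nonempty F] [MeasurableSpace G] [Add F]
    [MeasurableAdd₂ F]
    {U : Ω → E} {n Y : Ω → F} {X : Ω → G} (hU : AEMeasurable U P) (hn : AEMeasurable n P)
    (hX : AEMeasurable X P) (hind : IndepFun (fun ω => (X ω, U ω)) n P)
    {A : E → F} (hA : Measurable A) (hY : ∀ᵐ ω ∂P, Y ω = A (U ω) + n ω) :
    ∀ᵐ x ∂(P.map X),
      condDistrib (fun ω => (U ω, Y ω)) X P x =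
        ((condDistrib U X P x).prod (P.map n)).map (fun p => (p.1, A p.1 + p.2)) ∧
      condDistrib Y X P x =
        ((condDistrib U X P x).prod (P.map n)).map (fun p => A p.1 + p.2) := by
  have hm1 : Measurable fun p : E × F => (p.1, A p.1 + p.2) := by fun_prop
  have hm2 : Measurable fun p : E × F => A p.1 + p.2 := by fun_prop
  have e1 : (fun ω => (U ω, Y ω)) =ᵐ[P]
      (fun p : E × F => (p.1, A p.1 + p.2)) ∘ fun ω => (U ω, n ω) := by
    filter_upwards [hY] with ω h
    simp [h]
  have e2 : Y =ᵐ[P] (fun p : E × F => A p.1 + p.2) ∘ fun ω => (U ω, n ω) := by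
    filter_upwards [hY] with ω h
    simp [h]
  filter_upwards [condDistrib_prodMk_of_indep hU hn hX hind,
    condDistrib_comp X (hU.prodMk hn) hm1, condDistrib_comp X (hU.prodMk hn) hm2] with x h0 h1 h2
  rw [condDistrib_congr_left e1, condDistrib_congr_left e2, h1, h2, Kernel.map_apply _ hm1,
    Kernel.map_apply _ hm2, h0]
  exact ⟨rfl, rfl⟩

end Conditioning

/-! ### The forward diffusion in one step -/

section Forward

variable {Ω : Type*} [MeasurableSpace Ω] {d N : ℕ} {β : ℕ → ℝ}
  {pdata : Measure (EuclideanSpace ℝ (Fin d))} {X ε : ℕ → Ω → EuclideanSpace ℝ (Fin d)}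
  {P : Measure Ω}

theorem alphaBar_succ (β : ℕ → ℝ) (t : ℕ) :
    alphaBar β (t + 1) = (1 - β (t + 1)) * alphaBar β t := by
  rw [alphaBar, Finset.prod_Icc_succ_top (by omega), mul_comm]
  rfl

theorem alphaBar_pos (hβ : ∀ i ∈ Finset.Icc 1 N, 0 < β i ∧ β i < 1) {t : ℕ} (ht : t ≤ N) :
    0 < alphaBar β t :=
  Finset.prod_pos fun j hj => by
    rw [Finset.mem_Icc] at hj
    linarith [(hβ j (Finset.mem_Icc.2 ⟨hj.1, hj.2.trans ht⟩)).2]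

theorem alphaBar_lt_one (hβ : ∀ i ∈ Finset.Icc 1 N, 0 < β i ∧ β i < 1) {t : ℕ}
    (ht : t ∈ Finset.Icc 1 N) : alphaBar β t < 1 := by
  rw [Finset.mem_Icc] at ht
  obtain ⟨s, rfl⟩ : ∃ s, t = s + 1 := ⟨t - 1, by omega⟩
  have hpos := alphaBar_pos hβ (t := s) (by omega)
  have hle : alphaBar β s ≤ 1 := by
    refine Finset.prod_le_one (fun j hj => ?_) fun j hj => ?_ <;>
    · rw [Finset.mem_Icc] at hj
      have := hβ j (Finset.mem_Icc.2 ⟨hj.1, by omega⟩)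
      linarith
  have := hβ (s + 1) (Finset.mem_Icc.2 ht)
  rw [alphaBar_succ]
  nlinarith

/-- Unrolling the recursion: `X t` is a multiple of `X 0` plus a linear combination of the driving
noises, the squares of whose coefficients add up to `1 - ᾱ_t`. -/
theorem IsForwardDiffusion.exists_coeff (h : IsForwardDiffusion N β pdata X ε P) :
    ∀ t ≤ N, ∃ c : ℕ → ℝ, (∀ i, t < i → c i = 0) ∧
      ∑ i : Finset.Icc 1 N, c i ^ 2 = 1 - alphaBar β t ∧
      ∀ᵐ ω ∂P, X t ω = Real.sqrt (alphaBar β t) • X 0 ω + ∑ i : Finset.Icc 1 N, c i • ε i ω := by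
  intro t
  induction t with
  | zero =>
    intro _
    exact ⟨0, by simp, by simp [alphaBar], by simp [alphaBar]⟩
  | succ t ih =>
    intro ht
    obtain ⟨c, hc0, hc1, hc2⟩ := ih (by omega)
    have hmem : t + 1 ∈ Finset.Icc 1 N := Finset.mem_Icc.2 ⟨by omega, ht⟩
    obtain ⟨hb0, hb1⟩ := h.schedule _ hmem
    set b := β (t + 1)
    have hs : Real.sqrt (1 - b) ^ 2 = 1 - b := Real.sq_sqrt (by linarith)
    have hs' : Real.sqrt b ^ 2 = b := Real.sq_sqrt hb0.le
    refine ⟨fun i => Real.sqrt (1 - b) * c i + if i = t + 1 then Real.sqrt b else 0, ?_, ?_, ?_⟩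
    · intro i hi
      simp only
      rw [hc0 i (by omega), if_neg (by omega)]
      simp
    -- the noise `ε (t + 1)` has not been used before, so there is no cross term
    · have hsq : ∀ i : ℕ, (Real.sqrt (1 - b) * c i + if i = t + 1 then Real.sqrt b else 0) ^ 2 =
          (1 - b) * c i ^ 2 + if i = t + 1 then b else 0 := by
        intro i
        split_ifs with hi
        · rw [hi, hc0 _ (by omega), mul_zero, zero_add, hs']
          ring
        · rw [add_zero, mul_pow, hs, add_zero]
      simp_rw [hsq]
      rw [Finset.sum_add_distrib, ← Finset.mul_sum, hc1, alphaBar_succ,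
        Finset.sum_coe_sort (Finset.Icc 1 N) (fun i => if i = t + 1 then b else 0),
        Finset.sum_ite_eq' _ _ _, if_pos hmem]
      ring
    · filter_upwards [hc2, h.step t (by omega)] with ω h1 h2
      rw [h2, h1, alphaBar_succ, Real.sqrt_mul (by linarith)]
      simp_rw [add_smul]
      rw [Finset.sum_add_distrib, smul_add, smul_smul, Finset.smul_sum, add_assoc]
      simp_rw [smul_smul]
      congr 2
      simp_rw [ite_smul, zero_smul]
      rw [Finset.sum_coe_sort (Finset.Icc 1 N)
        (fun i => if i = t + 1 then Real.sqrt b • ε i ω else 0),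
        Finset.sum_ite_eq' _ _ _, if_pos hmem]

/-- The one-step form of the forward diffusion: `X t = √ᾱ_t X 0 + W`, where `W` is a function of the
driving noises with law `N(0, (1 - ᾱ_t) I)`. The law is given by its characteristic function, with
variance `1 / (2 b)` for `b = 1 / (2 (1 - ᾱ_t))`, as in `eq_withDensity_of_charFun`. -/
theorem IsForwardDiffusion.exists_noise [IsProbabilityMeasure P]
    (h : IsForwardDiffusion N β pdata X ε P) {t : ℕ} (ht : t ∈ Finset.Icc 1 N) :
    ∃ Φ : (Finset.Icc 1 N → EuclideanSpace ℝ (Fin d)) → EuclideanSpace ℝ (Fin d), Measurable Φ ∧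
      (∀ᵐ ω ∂P, X t ω = Real.sqrt (alphaBar β t) • X 0 ω + Φ fun i => ε i ω) ∧
      ∀ w, charFun (P.map fun ω => Φ fun i => ε i ω) w =
        Complex.exp (-((‖w‖ ^ 2 / (4 * (1 / (2 * (1 - alphaBar β t)))) : ℝ) : ℂ)) := by
  obtain ⟨c, -, hc1, hc2⟩ := h.exists_coeff t (Finset.mem_Icc.1 ht).2
  have hlt := alphaBar_lt_one h.schedule ht
  refine ⟨fun e => ∑ i : Finset.Icc 1 N, c i • e i, by fun_prop, hc2, fun w => ?_⟩
  have hm : ∀ i : Finset.Icc 1 N, AEMeasurable (ε i) P := fun i => (h.noise_law i i.2).aemeasurable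
  have hind : iIndepFun (fun (i : Finset.Icc 1 N) ω => c i • ε i ω) P :=
    h.noise_indep.comp (fun (i : Finset.Icc 1 N) e => c i • e) (fun i => by fun_prop)
  have hsm : ∀ i : Finset.Icc 1 N, AEMeasurable (fun ω => c i • ε i ω) P :=
    fun i => (hm i).const_smul (c i)
  rw [hind.charFun_map_fun_sum_eq_prod hsm, Finset.prod_apply]
  have hi : ∀ i : Finset.Icc 1 N, charFun (P.map fun ω => c i • ε i ω) w =
      Complex.exp (-((c i ^ 2 * ‖w‖ ^ 2 / 2 : ℝ) : ℂ)) := by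
    intro i
    rw [charFun_map_smul_comp (hm i), (h.noise_law i i.2).map_eq, charFun_stdGaussian, norm_smul,
      ← Complex.ofReal_pow, mul_pow, Real.norm_eq_abs, sq_abs]
    push_cast
    ring_nf
  simp_rw [hi]
  rw [← Complex.exp_sum, Finset.sum_neg_distrib, ← Complex.ofReal_sum, ← Finset.sum_div,
    ← Finset.sum_mul, hc1]
  congr 3
  have : 1 - alphaBar β t ≠ 0 := by linarith
  field_simp
  ring

end Forward

/-! ### The marginal density around a point with Gaussian posterior -/

section LogQuadratic

variable {d : ℕ}

/-- The quadratic polynomial in the exponent of the density of `X t` around a point `x` with a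
Gaussian posterior `N(μ, S)`, where the density of the noise is proportional to `exp (-b ‖v‖²)` and
the signal is scaled by `a`. It vanishes at `z = x`. -/
noncomputable def logProfile (a b : ℝ) (x μ : EuclideanSpace ℝ (Fin d))
    (S : Matrix (Fin d) (Fin d) ℝ) (z : EuclideanSpace ℝ (Fin d)) : ℝ :=
  -b * (‖z‖ ^ 2 - ‖x‖ ^ 2) + (inner ℝ ((2 * b * a) • (z - x)) μ +
    inner ℝ ((2 * b * a) • (z - x))
      (Matrix.toEuclideanCLM (𝕜 := ℝ) S ((2 * b * a) • (z - x))) / 2)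

theorem contDiff_logProfile (a b : ℝ) (x μ : EuclideanSpace ℝ (Fin d))
    (S : Matrix (Fin d) (Fin d) ℝ) : ContDiff ℝ 2 (logProfile a b x μ S) := by
  unfold logProfile
  have hs : ContDiff ℝ 2 fun z : EuclideanSpace ℝ (Fin d) => (2 * b * a) • (z - x) := by fun_prop
  have hT := (Matrix.toEuclideanCLM (𝕜 := ℝ) S).contDiff.comp hs
  exact (contDiff_const.mul ((contDiff_norm_sq ℝ).sub contDiff_const)).add
    ((hs.inner ℝ contDiff_const).add ((hs.inner ℝ hT).div_const 2))

theorem inner_toEuclideanCLM_single (S : Matrix (Fin d) (Fin d) ℝ) (i j : Fin d) :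
    inner ℝ (EuclideanSpace.single i (1 : ℝ))
      (Matrix.toEuclideanCLM (𝕜 := ℝ) S (EuclideanSpace.single j 1)) = S i j := by
  rw [Matrix.inner_toEuclideanCLM]
  simp

theorem hessian_const_add_logProfile (k a b : ℝ) (x μ y : EuclideanSpace ℝ (Fin d))
    {S : Matrix (Fin d) (Fin d) ℝ} (hS : S.IsHermitian) :
    hessian (fun z => k + logProfile a b x μ S z) y =
      (-(2 * b)) • (1 : Matrix (Fin d) (Fin d) ℝ) + (2 * b * a) ^ 2 • S := by
  set T := Matrix.toEuclideanCLM (𝕜 := ℝ) S with hT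
  set c := 2 * b * a with hc
  have h1 : ∀ z v, fderiv ℝ (fun z => k + logProfile a b x μ S z) z v =
      -b * (2 * inner ℝ z v) + (inner ℝ (c • v) μ +
        (inner ℝ (c • (z - x)) (T (c • v)) + inner ℝ (c • v) (T (c • (z - x)))) / 2) := by
    intro z v
    have hid := hasFDerivAt_id (𝕜 := ℝ) z
    have hs : HasFDerivAt (fun z : EuclideanSpace ℝ (Fin d) => c • (z - x))
        (c • ContinuousLinearMap.id ℝ _) z := (hid.sub_const x).const_smul c
    have hTs := T.hasFDerivAt.comp z hs
    have hn := hid.norm_sq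
    have h := (((hn.sub_const (‖x‖ ^ 2)).const_mul (-b)).add
      ((hs.inner ℝ (hasFDerivAt_const μ z)).add ((hs.inner ℝ hTs).mul_const (1 / 2)))).const_add k
    rw [(h.congr_of_eventuallyEq (f₁ := fun z => k + logProfile a b x μ S z)
      (Filter.Eventually.of_forall fun w => by simp [logProfile, ← hc, ← hT]; ring)).fderiv]
    simp
    ring
  ext i j
  simp only [hessian, Matrix.of_apply, h1]
  set ej : EuclideanSpace ℝ (Fin d) := EuclideanSpace.single j 1
  have hid := hasFDerivAt_id (𝕜 := ℝ) y
  have hs : HasFDerivAt (fun z : EuclideanSpace ℝ (Fin d) => c • (z - x))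
      (c • ContinuousLinearMap.id ℝ _) y := (hid.sub_const x).const_smul c
  have hTs := T.hasFDerivAt.comp y hs
  have h2 := (((hid.inner ℝ (hasFDerivAt_const ej y)).const_mul 2).const_mul (-b)).add
    ((((hs.inner ℝ (hasFDerivAt_const (T (c • ej)) y)).add
      ((hasFDerivAt_const (c • ej) y).inner ℝ hTs)).mul_const (1 / 2)).const_add
        (inner ℝ (c • ej) μ))
  rw [(h2.congr_of_eventuallyEq (f₁ := fun z => -b * (2 * inner ℝ z ej) + (inner ℝ (c • ej) μ +
        (inner ℝ (c • (z - x)) (T (c • ej)) + inner ℝ (c • ej) (T (c • (z - x)))) / 2))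
      (Filter.Eventually.of_forall fun w => by simp; ring)).fderiv]
  have hij := inner_toEuclideanCLM_single S i j
  have hji := inner_toEuclideanCLM_single S j i
  have hsymm : S j i = S i j := by simpa using hS.apply i j
  have hone : inner ℝ (EuclideanSpace.single i (1 : ℝ)) (EuclideanSpace.single j 1) =
      (1 : Matrix (Fin d) (Fin d) ℝ) i j := by
    rw [EuclideanSpace.inner_single_left]
    simp [Matrix.one_apply]
  rw [← hT] at hij hji
  simp [ej, real_inner_smul_left, real_inner_smul_right]
  rw [hone, hij, hji, hsymm]
  ring

end LogQuadratic

/-- If the posterior at one point `x` is Gaussian, then the prior is Gaussian up to the known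
likelihood factor, and the marginal density is determined at every other point. -/
theorem marginal_of_gaussian_posterior {d : ℕ} {π : Measure (EuclideanSpace ℝ (Fin d))}
    {a b C : ℝ} (hC : 0 < C) {x μ : EuclideanSpace ℝ (Fin d)} {S : Matrix (Fin d) (Fin d) ℝ}
    (hS : S.PosSemidef) {q : ℝ≥0∞} (h0 : q ≠ 0) (h1 : q ≠ ⊤)
    (hpost : multivariateGaussian μ S = π.withDensity
      fun u => ENNReal.ofReal (C * Real.exp (-b * ‖x - a • u‖ ^ 2)) / q)
    (z : EuclideanSpace ℝ (Fin d)) :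
    ∫⁻ u, ENNReal.ofReal (C * Real.exp (-b * ‖z - a • u‖ ^ 2)) ∂π =
      ENNReal.ofReal (q.toReal * Real.exp (logProfile a b x μ S z)) := by
  have hm : Measurable fun u : EuclideanSpace ℝ (Fin d) =>
      ENNReal.ofReal (C * Real.exp (-b * ‖x - a • u‖ ^ 2)) / q := by fun_prop
  have hexp := lintegral_exp_inner_multivariateGaussian hS μ ((2 * b * a) • (z - x))
  rw [hpost, lintegral_withDensity_eq_lintegral_mul _ hm (by fun_prop)] at hexp
  rw [logProfile, Real.exp_add, ENNReal.ofReal_mul ENNReal.toReal_nonneg,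
    ENNReal.ofReal_toReal h1, ENNReal.ofReal_mul (Real.exp_pos _).le, ← hexp, ← mul_assoc,
    ← lintegral_const_mul' _ _ (ENNReal.mul_ne_top h1 ENNReal.ofReal_ne_top)]
  refine lintegral_congr fun u => ?_
  rw [Pi.mul_apply]
  -- the terms `‖a • u‖²` in the two exponents cancel, so the likelihood ratio is log-linear in `u`
  have hr : C * Real.exp (-b * ‖z - a • u‖ ^ 2) = Real.exp (-b * (‖z‖ ^ 2 - ‖x‖ ^ 2)) *
      (C * Real.exp (-b * ‖x - a • u‖ ^ 2)) *
        Real.exp (inner ℝ ((2 * b * a) • (z - x)) u) := by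
    rw [show ∀ p q r s : ℝ, p * (q * r) * s = q * (p * r * s) from fun p q r s => by ring,
      ← Real.exp_add, ← Real.exp_add, norm_sub_sq_real, norm_sub_sq_real]
    simp only [real_inner_smul_left, real_inner_smul_right, inner_sub_left]
    congr 2
    ring
  rw [hr, ENNReal.ofReal_mul (by positivity), ENNReal.ofReal_mul (by positivity)]
  set e := ENNReal.ofReal (C * Real.exp (-b * ‖x - a • u‖ ^ 2))
  set e1 := ENNReal.ofReal (Real.exp (-b * (‖z‖ ^ 2 - ‖x‖ ^ 2)))
  set e2 := ENNReal.ofReal (Real.exp (inner ℝ ((2 * b * a) • (z - x)) u))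
  calc e1 * e * e2 = e1 * (q * (e / q)) * e2 := by rw [ENNReal.mul_div_cancel h0 h1]
    _ = q * e1 * (e / q * e2) := by ring

/-- A continuous real function whose positive part is a version of a continuous positive density
agrees with it everywhere. -/
theorem eq_of_withDensity_ofReal_eq {E : Type*} [TopologicalSpace E] [MeasurableSpace E]
    [BorelSpace E] {ν : Measure E} [SigmaFinite ν] [ν.IsOpenPosMeasure] {f g : E → ℝ}
    (hf : Continuous f) (hg : Continuous g) (hpos : ∀ x, 0 < g x)
    (h : ν.withDensity (fun x => ENNReal.ofReal (f x)) =
      ν.withDensity (fun x => ENNReal.ofReal (g x))) : f = g := by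
  rw [withDensity_eq_iff_of_sigmaFinite (by fun_prop) (by fun_prop)] at h
  refine (Continuous.ae_eq_iff_eq ν hf hg).1 ?_
  filter_upwards [h] with x hx
  have hfx : 0 < f x := by
    rw [← ENNReal.ofReal_pos, hx, ENNReal.ofReal_pos]
    exact hpos x
  exact (ENNReal.ofReal_eq_ofReal_iff hfx.le (hpos x).le).1 hx

end DiffusionCMI

/-! ### The covariance formula and the conditional mutual information -/

open DiffusionCMI

theorem theorem1 {Ω : Type*} [MeasurableSpace Ω] (P : Measure Ω) [IsProbabilityMeasure P]
    (d m N : ℕ) (β : ℕ → ℝ) (pdata : Measure (EuclideanSpace ℝ (Fin d)))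
    (X ε : ℕ → Ω → EuclideanSpace ℝ (Fin d))
    (hX : DiffusionCMI.IsForwardDiffusion N β pdata X ε P)
    (A : Matrix (Fin m) (Fin d) ℝ) (Sn : Matrix (Fin m) (Fin m) ℝ) (hSn : Sn.PosDef)
    (n Y : Ω → EuclideanSpace ℝ (Fin m))
    (hY : DiffusionCMI.IsMeasurement N A Sn X ε n Y P)
    (t : ℕ) (ht : t ∈ Finset.Icc 1 N)
    -- the (unique) continuous density of the law of `X t`
    (pt : EuclideanSpace ℝ (Fin d) → ℝ) (hpt_cont : Continuous pt)
    (hpt : HasLaw (X t) (volume.withDensity fun x => ENNReal.ofReal (pt x)) P) :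
    ∀ᵐ x ∂(P.map (X t)),
      ∀ (mpost : EuclideanSpace ℝ (Fin d)) (Spost Sposty : Matrix (Fin d) (Fin d) ℝ),
        Spost.PosDef →
        condDistrib (X 0) (X t) P x = multivariateGaussian mpost Spost →
        Sposty = (Spost⁻¹ + A.transpose * Sn⁻¹ * A)⁻¹ →
          0 < pt x ∧ ContDiffAt ℝ 2 pt x ∧
          Spost = ((1 - DiffusionCMI.alphaBar β t) / DiffusionCMI.alphaBar β t) •
            (1 + (1 - DiffusionCMI.alphaBar β t) •
              DiffusionCMI.hessian (fun z => Real.log (pt z)) x) ∧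
          DiffusionCMI.condMutualInfo (X 0) Y (X t) P x ≠ ⊤ ∧
          (DiffusionCMI.condMutualInfo (X 0) Y (X t) P x).toReal =
            1 / 2 * Real.log (Spost.det / Sposty.det) := by
  obtain ⟨Φ, hΦ, hXt, hchar⟩ := hX.exists_noise ht
  have hα0 : 0 < alphaBar β t := alphaBar_pos hX.schedule (Finset.mem_Icc.1 ht).2
  have hα1 : alphaBar β t < 1 := alphaBar_lt_one hX.schedule ht
  set α := alphaBar β t
  have hX0 : AEMeasurable (X 0) P := hX.init.aemeasurable
  have hε : AEMeasurable (fun ω (i : Finset.Icc 1 N) => ε i ω) P :=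
    aemeasurable_pi_lambda _ fun i => (hX.noise_law i i.2).aemeasurable
  have hW : AEMeasurable (fun ω => Φ fun i => ε i ω) P := hΦ.comp_aemeasurable hε
  have hXtm : AEMeasurable (X t) P := hpt.aemeasurable
  have hn : AEMeasurable n P := hY.noise_law.aemeasurable
  have hindW : IndepFun (X 0) (fun ω => Φ fun i => ε i ω) P :=
    hX.init_indep.comp measurable_id hΦ
  have hindn : IndepFun (fun ω => (X t ω, X 0 ω)) n P := by
    have h := hY.noise_indep.comp (φ := fun p => (Real.sqrt α • p.1 + Φ p.2, p.1))
      (by fun_prop) measurable_id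
    refine h.congr ?_ Filter.EventuallyEq.rfl
    filter_upwards [hXt] with ω hω
    simp [hω]
  set b := 1 / (2 * (1 - α)) with hb
  have hbpos : 0 < b := by
    have : 0 < 1 - α := by linarith
    positivity
  set C := gaussConst (EuclideanSpace ℝ (Fin d)) b
  have hC : 0 < C := gaussConst_pos hbpos
  have : IsProbabilityMeasure (P.map fun ω => Φ fun i => ε i ω) :=
    Measure.isProbabilityMeasure_map hW
  have : IsProbabilityMeasure (P.map (X 0)) := Measure.isProbabilityMeasure_map hX0
  have hWg := eq_withDensity_of_charFun _ hbpos hchar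
  set q : EuclideanSpace ℝ (Fin d) → ℝ≥0∞ := fun x =>
    ∫⁻ u, ENNReal.ofReal (C * Real.exp (-b * ‖x - Real.sqrt α • u‖ ^ 2)) ∂(P.map (X 0)) with hq
  have hq0 : ∀ x, q x ≠ 0 := by
    intro x hx
    rw [hq, lintegral_eq_zero_iff (by fun_prop)] at hx
    obtain ⟨u, hu⟩ := hx.exists
    rw [Pi.zero_apply, ENNReal.ofReal_eq_zero] at hu
    exact absurd hu (not_le.2 (by positivity))
  have hq1 : ∀ x, q x ≠ ⊤ := by
    intro x
    refine ne_top_of_le_ne_top (ENNReal.ofReal_ne_top (r := C)) ?_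
    calc q x ≤ ∫⁻ _, ENNReal.ofReal C ∂(P.map (X 0)) := by
          refine lintegral_mono fun u => ENNReal.ofReal_le_ofReal ?_
          refine mul_le_of_le_one_right hC.le (Real.exp_le_one_iff.2 ?_)
          have : 0 ≤ b * ‖x - Real.sqrt α • u‖ ^ 2 := by positivity
          linarith
      _ = ENNReal.ofReal C := by simp
  obtain ⟨hmarg, hbayes⟩ := condDistrib_additiveNoise hX0 hW hindW
    (g := fun v => ENNReal.ofReal (C * Real.exp (-b * ‖v‖ ^ 2))) (by fun_prop) hWg hXt hq0 hq1
  have hAm : Measurable A.toEuclideanLin :=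
    (LinearMap.continuous_of_finiteDimensional _).measurable
  filter_upwards [hbayes, condDistrib_measurement hX0 hn hXtm hindn hAm hY.eq]
    with x hx1 ⟨hx2, hx3⟩ μ S Sy hS hpost hSy
  have hqz := marginal_of_gaussian_posterior hC hS.posSemidef (hq0 x) (hq1 x) (hpost.symm.trans hx1)
  set K := (q x).toReal
  have hK : 0 < K := ENNReal.toReal_pos (hq0 x) (hq1 x)
  have hφ := contDiff_logProfile (Real.sqrt α) b x μ S
  have hpteq : pt = fun z => K * Real.exp (logProfile (Real.sqrt α) b x μ S z) := by
    refine eq_of_withDensity_ofReal_eq (ν := volume) hpt_cont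
      (continuous_const.mul (Real.continuous_exp.comp hφ.continuous))
      (fun z => mul_pos hK (Real.exp_pos _)) ?_
    rw [← hpt.map_eq, hmarg]
    congr 1
    exact funext hqz
  refine ⟨?_, ?_, ?_, ?_⟩
  · rw [hpteq]
    exact mul_pos hK (Real.exp_pos _)
  · rw [hpteq]
    exact (contDiff_const.mul (Real.contDiff_exp.comp hφ)).contDiffAt
  · have hlog : (fun z => Real.log (pt z)) =
        fun z => Real.log K + logProfile (Real.sqrt α) b x μ S z := by
      funext z
      rw [hpteq]
      simp only
      rw [Real.log_mul hK.ne' (Real.exp_pos _).ne', Real.log_exp]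
    rw [hlog, hessian_const_add_logProfile _ _ _ _ _ _ hS.isHermitian, mul_pow, Real.sq_sqrt hα0.le]
    have h1α : 1 - α ≠ 0 := by linarith
    rw [hb]
    ext i j
    simp only [Matrix.smul_apply, Matrix.add_apply, smul_eq_mul]
    field_simp
    ring
  · rw [condMutualInfo, hx2, hx3, hpost, hY.noise_law.map_eq, map_channel_output hS hSn, hSy,
      ← det_channelCov_div hS hSn A]
    exact klDiv_channel hS hSn A μ
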